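/- Let $(R,g)$ be a smooth ($C^\infty$) Riemannian manifold without boundary, Hausdorff and second countable, of finite dimension $m$. A coordinate rectangle of $R$ is a chart of the smooth structure whose image is an open rectangle $\prod_{i=1}^m(a_i,b_i)\subset\mathbb R^m$. A function $f:R\to\mathbb R$ is a Tonelli function if in every coordinate rectangle its coordinate expression is continuous, is for every $i$ locally absolutely continuous in $x_i$ for almost every value of the other variables, and has partial derivatives in $L^2_{loc}$. The Royden algebra $\mathbb M(R)$ is the algebra of bounded continuous Tonelli functions $f$ on $R$ with finite Dirichlet integral $D_R(f)=\int_R|\nabla f|^2\,dV<\infty$. A Royden compactification of $R$ is a topological space $R^*$ such that: (1) $R^*$ is a compact Hausdorff space; (2) $R$ is an open dense (topological) subspace of $R^*$; (3) every $f\in\mathbb M(R)$ extends to a continuous function $\bar f:R^*\to\mathbb R$; (4) the extensions $\bar f$, $f\in\mathbb M(R)$, separate the points of $R^*$. Theorem. Every such $R$ has a Royden compactification $R^*$, and it is unique up to homeomorphisms fixing the points of $R$. More precisely, the set of characters (unital multiplicative linear functionals $\chi:\mathbb M(R)\to\mathbb R$) with the weak-* topology (pointwise convergence on $\mathbb M(R)$),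 in which $R$ is embedded by $p\mapsto(f\mapsto f(p))$, is a Royden compactification of $R$; and for every Royden compactification $X$ of $R$ the map $\sigma(x)(f)=\bar f(x)$ is a homeomorphism of $X$ onto this space of characters that fixes the points of $R$. -/

import Mathlib

open scoped Manifold ContDiff
open MeasureTheory

universe u v w

noncomputable section

namespace Royden

/-- A coordinate rectangle of a smooth `m`-dimensional manifold `R`: a chart of the smooth structure
whose image is an open rectangle `∏ᵢ (lo i, hi i)`. -/
structure CoordRectangle (m : ℕ) (R : Type*) [TopologicalSpace R]
    [ChartedSpace (EuclideanSpace ℝ (Fin m)) R] where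
  /-- the chart -/
  chart : OpenPartialHomeomorph R (EuclideanSpace ℝ (Fin m))
  chart_mem : chart ∈ IsManifold.maximalAtlas (𝓡 m) ∞ R
  /-- left endpoints -/
  lo : Fin m → ℝ
  /-- right endpoints -/
  hi : Fin m → ℝ
  target_eq : chart.target = {x | ∀ i, x i ∈ Set.Ioo (lo i) (hi i)}

/-- The `i`-th partial derivative of a function on `ℝ^m`. -/
def partialDeriv {m : ℕ} (i : Fin m) (F : EuclideanSpace ℝ (Fin m) → ℝ)
    (x : EuclideanSpace ℝ (Fin m)) : ℝ :=
  lineDeriv ℝ F x (EuclideanSpace.single i 1)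

/-- Tonelli functions on the open rectangle `∏ᵢ (a i, b i)`: continuous functions that are, for
every `i`, locally absolutely continuous (that is, absolutely continuous on every compact
subinterval) on almost every segment parallel to the `i`-th axis, and whose partial derivatives are
square integrable on compact subsets of the rectangle.
The field `ae_hasPartial`, the almost everywhere existence of the partial derivatives, is a
consequence of absolute continuity; it is recorded to make explicit that `partialDeriv` is not a
default value. -/
structure IsTonelliOn {m : ℕ} (a b : Fin m → ℝ) (F : EuclideanSpace ℝ (Fin m) → ℝ) : Prop where
  continuousOn : ContinuousOn F {x | ∀ i, x i ∈ Set.Ioo (a i) (b i)}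
  ae_absolutelyContinuous : ∀ i : Fin m,
    ∀ᵐ x ∂(volume.restrict {x : EuclideanSpace ℝ (Fin m) | ∀ i, x i ∈ Set.Ioo (a i) (b i)}),
      ∀ c ∈ Set.Ioo (a i) (b i), ∀ d ∈ Set.Ioo (a i) (b i),
        AbsolutelyContinuousOnInterval
          (fun z : ℝ => F (WithLp.toLp 2 (Function.update x.ofLp i z))) c d
  ae_hasPartial : ∀ i : Fin m,
    ∀ᵐ x ∂(volume.restrict {x : EuclideanSpace ℝ (Fin m) | ∀ i, x i ∈ Set.Ioo (a i) (b i)}),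
      LineDifferentiableAt ℝ F x (EuclideanSpace.single i 1)
  memLp_partial : ∀ i : Fin m, ∀ K : Set (EuclideanSpace ℝ (Fin m)), IsCompact K →
    K ⊆ {x | ∀ i, x i ∈ Set.Ioo (a i) (b i)} →
      MemLp (partialDeriv i F) 2 (volume.restrict K)

section Manifold

variable {m : ℕ} {R : Type*} [TopologicalSpace R] [ChartedSpace (EuclideanSpace ℝ (Fin m)) R]

/-- A function on a manifold is a Tonelli function if it is one in every coordinate rectangle. -/
def IsTonelli (m : ℕ) {R : Type*} [TopologicalSpace R]
    [ChartedSpace (EuclideanSpace ℝ (Fin m)) R] (f : R → ℝ) : Prop :=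
  ∀ T : CoordRectangle m R, IsTonelliOn T.lo T.hi (f ∘ T.chart.symm)

/-- The `i`-th coordinate vector field `∂/∂xⁱ` of a coordinate rectangle, at the point with
coordinates `x`. -/
def CoordRectangle.coordVector (T : CoordRectangle m R) (i : Fin m)
    (x : EuclideanSpace ℝ (Fin m)) : TangentSpace (𝓡 m) (T.chart.symm x) :=
  mfderiv (𝓡 m) (𝓡 m) T.chart.symm x
    (EuclideanSpace.single i 1 : EuclideanSpace ℝ (Fin m))

theorem aemeasurable_of_isCompact {F : EuclideanSpace ℝ (Fin m) → ℝ}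
    {U : Set (EuclideanSpace ℝ (Fin m))} (hU : IsOpen U)
    (h : ∀ K, IsCompact K → K ⊆ U → AEMeasurable F (volume.restrict K)) :
    AEMeasurable F (volume.restrict U) := by
  obtain ⟨s, hs, hsU, hun, -⟩ := hU.exists_iUnion_isClosed
  have : U = ⋃ p : ℕ × ℕ, s p.1 ∩ Metric.closedBall 0 p.2 := by
    ext x
    simp only [Set.mem_iUnion, Prod.exists, Set.mem_inter_iff]
    constructor
    · intro hx
      rw [← hun] at hx
      obtain ⟨n, hn⟩ := Set.mem_iUnion.1 hx
      obtain ⟨k, hk⟩ := exists_nat_ge ‖x‖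
      exact ⟨n, k, hn, by simpa using hk⟩
    · rintro ⟨n, k, hn, -⟩
      exact hsU n hn
  rw [this, aemeasurable_iUnion_iff]
  intro p
  exact h _ ((isCompact_closedBall _ _).inter_left (hs _)) (Set.inter_subset_left.trans (hsU _))

theorem IsTonelli.aemeasurable_partialDeriv {f : R → ℝ} (hf : IsTonelli m f)
    (T : CoordRectangle m R) (i : Fin m) :
    AEMeasurable (partialDeriv i (f ∘ T.chart.symm)) (volume.restrict T.chart.target) :=
  aemeasurable_of_isCompact T.chart.open_target fun K hK hKU =>
    ((hf T).memLp_partial i K hK (T.target_eq ▸ hKU)).aestronglyMeasurable.aemeasurable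

variable [IsManifold (𝓡 m) ∞ R]

/-- A smooth Riemannian metric on `R`: a smooth family of inner products on the tangent spaces. -/
abbrev Metric (m : ℕ) (R : Type*) [TopologicalSpace R]
    [ChartedSpace (EuclideanSpace ℝ (Fin m)) R] [IsManifold (𝓡 m) ∞ R] : Type _ :=
  Bundle.ContMDiffRiemannianMetric (𝓡 m) ∞ (EuclideanSpace ℝ (Fin m))
    (fun p : R => TangentSpace (𝓡 m) p)

/-- The matrix `g_{ij}` of the metric in the coordinates of a coordinate rectangle. -/
def gramMatrix (g : Metric m R) (T : CoordRectangle m R) (x : EuclideanSpace ℝ (Fin m)) :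
    Matrix (Fin m) (Fin m) ℝ :=
  Matrix.of fun i j => g.inner (T.chart.symm x) (T.coordVector i x) (T.coordVector j x)

/-- The density of `|∇f|² dV` with respect to Lebesgue measure in a coordinate rectangle:
`∑ g^{ij} ∂_i f ∂_j f √|g|`. -/
def energyDensity (g : Metric m R) (T : CoordRectangle m R) (f : R → ℝ)
    (x : EuclideanSpace ℝ (Fin m)) : ℝ :=
  (∑ i, ∑ j, (gramMatrix g T x)⁻¹ i j * partialDeriv i (f ∘ T.chart.symm) x *
    partialDeriv j (f ∘ T.chart.symm) x) * √(gramMatrix g T x).det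

/-- A (countable, smooth) partition of unity subordinate to a covering by coordinate rectangles. -/
structure RectPartition (m : ℕ) (R : Type*) [TopologicalSpace R]
    [ChartedSpace (EuclideanSpace ℝ (Fin m)) R] where
  /-- the coordinate rectangles -/
  rect : ℕ → CoordRectangle m R
  /-- the partition of unity -/
  toPartition : SmoothPartitionOfUnity ℕ (𝓡 m) R
  subordinate : toPartition.IsSubordinate fun n => (rect n).chart.source

/-- Every point lies in a coordinate rectangle. -/
theorem exists_coordRectangle {m : ℕ} {R : Type*} [TopologicalSpace R]
    [ChartedSpace (EuclideanSpace ℝ (Fin m)) R] [IsManifold (𝓡 m) ∞ R] (p : R) :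
    ∃ T : CoordRectangle m R, p ∈ T.chart.source := by
  let e := chartAt (EuclideanSpace ℝ (Fin m)) p
  have hp : p ∈ e.source := mem_chart_source _ p
  have hU : IsOpen ((WithLp.toLp 2 : (Fin m → ℝ) → EuclideanSpace ℝ (Fin m)) ⁻¹' e.target) :=
    e.open_target.preimage (PiLp.continuous_toLp 2 _)
  obtain ⟨r, hr, hball⟩ := Metric.isOpen_iff.1 hU (e p).ofLp (by simpa using e.map_source hp)
  let B : Set (EuclideanSpace ℝ (Fin m)) := {x | ∀ i, x i ∈ Set.Ioo (e p i - r) (e p i + r)}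
  have hB : IsOpen B := by
    have : B = ⋂ i, (fun x : EuclideanSpace ℝ (Fin m) => x i) ⁻¹'
        Set.Ioo (e p i - r) (e p i + r) := by ext; simp [B]
    rw [this]
    exact isOpen_iInter_of_finite fun i => isOpen_Ioo.preimage (by fun_prop)
  have hBt : B ⊆ e.target := by
    intro x hx
    have : x.ofLp ∈ Metric.ball (e p).ofLp r := by
      rw [Metric.mem_ball, dist_pi_lt_iff hr]
      intro i
      rw [Real.dist_eq, abs_lt]
      have := hx i
      constructor <;> linarith [this.1, this.2]
    simpa using hball this
  have hs : IsOpen (e.source ∩ e ⁻¹' B) := e.isOpen_inter_preimage hB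
  refine ⟨⟨e.restr (e.source ∩ e ⁻¹' B),
    restr_mem_maximalAtlas _ (IsManifold.chart_mem_maximalAtlas p) hs,
    fun i => e p i - r, fun i => e p i + r, ?_⟩, ?_⟩
  · rw [OpenPartialHomeomorph.restr_target, hs.interior_eq]
    ext x
    constructor
    · rintro ⟨hx, -, h⟩
      simpa [B, e.right_inv hx] using (show e (e.symm x) ∈ B from h)
    · intro hx
      have hxt := hBt hx
      refine ⟨hxt, e.map_target hxt, ?_⟩
      simpa [B, e.right_inv hxt] using hx
  · rw [OpenPartialHomeomorph.restr_source, hs.interior_eq]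
    exact ⟨hp, hp, fun i => ⟨by linarith, by linarith⟩⟩

/-- Partitions of unity as in `RectPartition` exist. -/
theorem nonempty_rectPartition {m : ℕ} {R : Type*} [TopologicalSpace R] [T2Space R]
    [SecondCountableTopology R] [ChartedSpace (EuclideanSpace ℝ (Fin m)) R]
    [IsManifold (𝓡 m) ∞ R] [Nonempty R] : Nonempty (RectPartition m R) := by
  choose T hT using exists_coordRectangle (m := m) (R := R)
  obtain ⟨s, hs, hun⟩ := TopologicalSpace.countable_cover_nhds
    (fun p => (T p).chart.open_source.mem_nhds (hT p))
  have hne : s.Nonempty := by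
    by_contra h
    rw [Set.not_nonempty_iff_eq_empty] at h
    simp [h] at hun
    exact (Set.empty_ne_univ hun)
  obtain ⟨q, hq⟩ := hs.exists_eq_range hne
  have : LocallyCompactSpace R := ChartedSpace.locallyCompactSpace (EuclideanSpace ℝ (Fin m)) R
  obtain ⟨ρ, hρ⟩ := SmoothPartitionOfUnity.exists_isSubordinate (𝓡 m) isClosed_univ
    (fun n => (T (q n)).chart.source) (fun n => (T (q n)).chart.open_source) (by
      intro x _
      have : x ∈ ⋃ p ∈ s, (T p).chart.source := hun ▸ Set.mem_univ x
      simp only [hq, Set.mem_iUnion, Set.mem_range] at this ⊢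
      obtain ⟨_, ⟨n, rfl⟩, h⟩ := this
      exact ⟨n, h⟩)
  exact ⟨⟨fun n => T (q n), ρ, hρ⟩⟩

/-- The Dirichlet integral `D_R(f) = ∫_R |∇f|² dV = ∑ₙ ∫_R λₙ |∇f|² dV`, computed with a partition
of unity `λₙ` subordinate to a covering by coordinate rectangles. -/
def dirichletIntegral (g : Metric m R) (P : RectPartition m R) (f : R → ℝ) : ENNReal :=
  ∑' n, ∫⁻ x in (P.rect n).chart.target, ENNReal.ofReal
    (P.toPartition n ((P.rect n).chart.symm x) * energyDensity g (P.rect n) f x)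

/-- The functions of the Royden algebra `M(R)`: bounded continuous Tonelli functions with finite
Dirichlet integral. (The value of the Dirichlet integral does not depend on the partition of unity,
and no particular one is singled out; such partitions of unity exist by `nonempty_rectPartition`.) -/
structure IsRoyden (g : Metric m R) (f : R → ℝ) : Prop where
  continuous : Continuous f
  bounded : ∃ C, ∀ p, |f p| ≤ C
  tonelli : IsTonelli m f
  dirichlet_lt_top : ∀ P : RectPartition m R, dirichletIntegral g P f < ⊤

theorem continuousOn_gramMatrix (g : Metric m R) (T : CoordRectangle m R) (i j : Fin m) :
    ContinuousOn (fun x => gramMatrix g T x i j) T.chart.target := by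
  have hsm : ContMDiffOn (𝓡 m) (𝓡 m) ∞ T.chart.symm T.chart.target :=
    contMDiffOn_symm_of_mem_maximalAtlas T.chart_mem
  have hvec : ∀ k : Fin m, ContMDiffOn (𝓡 m) ((𝓡 m).prod (𝓡 m)) ∞
      (fun x => Bundle.TotalSpace.mk' (EuclideanSpace ℝ (Fin m))
        (E := fun p : R => TangentSpace (𝓡 m) p) (T.chart.symm x) (T.coordVector k x))
      T.chart.target := by
    intro k
    have h1 := hsm.contMDiffOn_tangentMapWithin (m := ∞) (by simp)
      T.chart.open_target.uniqueMDiffOn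
    have h2 : ContMDiff (𝓡 m) ((𝓡 m).prod (𝓡 m)) ∞
        (fun x : EuclideanSpace ℝ (Fin m) =>
          Bundle.TotalSpace.mk' (EuclideanSpace ℝ (Fin m))
          (E := fun p : EuclideanSpace ℝ (Fin m) => TangentSpace (𝓡 m) p) x
          (EuclideanSpace.single k (1 : ℝ) : EuclideanSpace ℝ (Fin m))) := by
      exact contMDiff_vectorSpace_iff_contDiff.2 contDiff_const
    have h3 := h1.comp h2.contMDiffOn (s := T.chart.target) (fun x hx => hx)
    refine h3.congr fun x hx => ?_
    simp only [Function.comp, tangentMapWithin, CoordRectangle.coordVector]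
    rw [mfderivWithin_of_isOpen T.chart.open_target hx]
  intro x hx
  have hg : ContMDiffWithinAt (𝓡 m) ((𝓡 m).prod 𝓘(ℝ, EuclideanSpace ℝ (Fin m) →L[ℝ]
      EuclideanSpace ℝ (Fin m) →L[ℝ] ℝ)) ∞
      (fun y => Bundle.TotalSpace.mk' (EuclideanSpace ℝ (Fin m) →L[ℝ]
        EuclideanSpace ℝ (Fin m) →L[ℝ] ℝ)
        (E := fun p : R => TangentSpace (𝓡 m) p →L[ℝ] TangentSpace (𝓡 m) p →L[ℝ] ℝ)
        (T.chart.symm y) (g.inner (T.chart.symm y))) T.chart.target x :=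
    ContMDiffAt.comp_contMDiffWithinAt x g.contMDiff.contMDiffAt (hsm x hx)
  have key : ContMDiffWithinAt (𝓡 m) ((𝓡 m).prod 𝓘(ℝ)) ∞
      (fun y => Bundle.TotalSpace.mk' ℝ (E := Bundle.Trivial R ℝ) (T.chart.symm y)
        (g.inner (T.chart.symm y) (T.coordVector i y) (T.coordVector j y))) T.chart.target x := by
    apply ContMDiffWithinAt.clm_bundle_apply₂ (F₁ := EuclideanSpace ℝ (Fin m))
      (F₂ := EuclideanSpace ℝ (Fin m))
    · exact hg
    · exact hvec i x hx
    · exact hvec j x hx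
  rw [Bundle.contMDiffWithinAt_totalSpace] at key
  exact key.2.continuousWithinAt

theorem posSemidef_gramMatrix (g : Metric m R) (T : CoordRectangle m R)
    (x : EuclideanSpace ℝ (Fin m)) : (gramMatrix g T x).PosSemidef := by
  refine Matrix.PosSemidef.of_dotProduct_mulVec_nonneg ?_ fun c => ?_
  · ext i j
    simp [gramMatrix, Matrix.conjTranspose_apply, g.symm _ (T.coordVector i x)]
  · have h : star c ⬝ᵥ (gramMatrix g T x).mulVec c =
        g.inner (T.chart.symm x) (∑ i, c i • T.coordVector i x) (∑ i, c i • T.coordVector i x) := by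
      simp [gramMatrix, dotProduct, Matrix.mulVec, Finset.mul_sum, map_sum]
      refine Finset.sum_congr rfl fun i _ => Finset.sum_congr rfl fun j _ => ?_
      rw [g.symm _ (T.coordVector i x)]
      ring
    rw [h]
    by_cases h0 : (∑ i, c i • T.coordVector i x) = 0
    · rw [h0]; simp
    · exact (g.pos _ _ h0).le

theorem IsTonelli.aemeasurable_energyDensity (g : Metric m R) {f : R → ℝ} (hf : IsTonelli m f)
    (T : CoordRectangle m R) :
    AEMeasurable (energyDensity g T f) (volume.restrict T.chart.target) := by
  have hG : ∀ i j, AEMeasurable (fun x => gramMatrix g T x i j)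
      (volume.restrict T.chart.target) := fun i j =>
    (continuousOn_gramMatrix g T i j).aemeasurable T.chart.open_target.measurableSet
  have hGm : AEMeasurable (fun x => (fun i j => gramMatrix g T x i j : Fin m → Fin m → ℝ))
      (volume.restrict T.chart.target) :=
    aemeasurable_pi_lambda _ fun i => aemeasurable_pi_lambda _ fun j => hG i j
  have hdet : Continuous (fun A : Fin m → Fin m → ℝ => (Matrix.of A).det) :=
    Continuous.matrix_det (continuous_id)
  have hadj : ∀ i j, Continuous (fun A : Fin m → Fin m → ℝ => (Matrix.of A).adjugate i j) :=
    fun i j => Continuous.matrix_elem (Continuous.matrix_adjugate continuous_id) i j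
  have hd : AEMeasurable (fun x => (gramMatrix g T x).det) (volume.restrict T.chart.target) :=
    hdet.measurable.comp_aemeasurable hGm
  have hinv : ∀ i j, AEMeasurable (fun x => (gramMatrix g T x)⁻¹ i j)
      (volume.restrict T.chart.target) := by
    intro i j
    have : (fun x => (gramMatrix g T x)⁻¹ i j) =
        fun x => ((gramMatrix g T x).det)⁻¹ * (gramMatrix g T x).adjugate i j := by
      ext x
      simp [Matrix.inv_def]
    rw [this]
    exact hd.inv.mul ((hadj i j).measurable.comp_aemeasurable hGm)
  have hp := hf.aemeasurable_partialDeriv T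
  unfold energyDensity
  exact (Finset.aemeasurable_fun_sum _ fun i _ => Finset.aemeasurable_fun_sum _ fun j _ =>
    ((hinv i j).mul (hp i)).mul (hp j)).mul hd.sqrt

theorem form_le {M : Matrix (Fin m) (Fin m) ℝ} (hM : M.PosSemidef) (u v : Fin m → ℝ)
    {α β C : ℝ} (hα : |α| ≤ C) (hβ : |β| ≤ C) :
    ∑ i, ∑ j, M i j * (α * u i + β * v i) * (α * u j + β * v j) ≤
      2 * C ^ 2 * (∑ i, ∑ j, M i j * u i * u j) + 2 * C ^ 2 * (∑ i, ∑ j, M i j * v i * v j) := by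
  have pos : ∀ w : Fin m → ℝ, 0 ≤ ∑ i, ∑ j, M i j * w i * w j := by
    intro w
    have := hM.dotProduct_mulVec_nonneg w
    simp only [dotProduct, Matrix.mulVec, Finset.mul_sum] at this
    refine this.trans_eq (Finset.sum_congr rfl fun i _ => Finset.sum_congr rfl fun j _ => ?_)
    change w i * _ = _
    ring
  have h1 := pos (fun i => α * u i - β * v i)
  have h2 : ∑ i, ∑ j, M i j * (α * u i + β * v i) * (α * u j + β * v j) +
      ∑ i, ∑ j, M i j * (α * u i - β * v i) * (α * u j - β * v j) =
      2 * α ^ 2 * (∑ i, ∑ j, M i j * u i * u j) + 2 * β ^ 2 * (∑ i, ∑ j, M i j * v i * v j) := by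
    simp only [Finset.mul_sum, ← Finset.sum_add_distrib]
    refine Finset.sum_congr rfl fun i _ => Finset.sum_congr rfl fun j _ => ?_
    ring
  have ha : α ^ 2 ≤ C ^ 2 := sq_le_sq' (abs_le.1 hα).1 (abs_le.1 hα).2
  have hb : β ^ 2 ≤ C ^ 2 := sq_le_sq' (abs_le.1 hβ).1 (abs_le.1 hβ).2
  nlinarith [pos u, pos v, mul_le_mul_of_nonneg_right ha (pos u),
    mul_le_mul_of_nonneg_right hb (pos v)]

theorem dirichletIntegral_lt_top_of_combination (g : Metric m R) {f₁ f₂ h α β : R → ℝ} {C : ℝ}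
    (hf₁ : IsRoyden g f₁) (hf₂ : IsRoyden g f₂) (hα : ∀ p, |α p| ≤ C) (hβ : ∀ p, |β p| ≤ C)
    (H : ∀ T : CoordRectangle m R, ∀ᵐ x ∂(volume.restrict T.chart.target), ∀ i,
      partialDeriv i (h ∘ T.chart.symm) x =
        α (T.chart.symm x) * partialDeriv i (f₁ ∘ T.chart.symm) x +
        β (T.chart.symm x) * partialDeriv i (f₂ ∘ T.chart.symm) x) (P : RectPartition m R) :
    dirichletIntegral g P h < ⊤ := by
  have key : dirichletIntegral g P h ≤
      ENNReal.ofReal (2 * C ^ 2) * dirichletIntegral g P f₁ +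
      ENNReal.ofReal (2 * C ^ 2) * dirichletIntegral g P f₂ := by
    unfold dirichletIntegral
    rw [← ENNReal.tsum_mul_left, ← ENNReal.tsum_mul_left, ← ENNReal.tsum_add]
    refine ENNReal.tsum_le_tsum fun n => ?_
    rw [← lintegral_const_mul' _ _ ENNReal.ofReal_ne_top,
      ← lintegral_const_mul' _ _ ENNReal.ofReal_ne_top]
    have hρ : AEMeasurable (fun x => P.toPartition n ((P.rect n).chart.symm x))
        (volume.restrict (P.rect n).chart.target) :=
      (((P.toPartition n).contMDiff.continuous.comp_continuousOn
        (P.rect n).chart.continuousOn_symm)).aemeasurable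
        (P.rect n).chart.open_target.measurableSet
    rw [← lintegral_add_left']
    · refine lintegral_mono_ae ?_
      filter_upwards [H (P.rect n)] with x hx
      have hC : (0 : ℝ) ≤ 2 * C ^ 2 := by positivity
      rw [← ENNReal.ofReal_mul hC, ← ENNReal.ofReal_mul hC]
      refine le_trans (ENNReal.ofReal_le_ofReal ?_) (ENNReal.ofReal_add_le)
      have hn : 0 ≤ P.toPartition n ((P.rect n).chart.symm x) := P.toPartition.nonneg n _
      have hs : 0 ≤ √(gramMatrix g (P.rect n) x).det := Real.sqrt_nonneg _
      have := form_le (posSemidef_gramMatrix g (P.rect n) x).inv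
        (fun i => partialDeriv i (f₁ ∘ (P.rect n).chart.symm) x)
        (fun i => partialDeriv i (f₂ ∘ (P.rect n).chart.symm) x)
        (hα ((P.rect n).chart.symm x)) (hβ ((P.rect n).chart.symm x))
      have h2 := mul_le_mul_of_nonneg_left (mul_le_mul_of_nonneg_right this hs) hn
      simp only [energyDensity, hx]
      refine h2.trans (le_of_eq ?_)
      ring
    · exact ((hρ.mul (hf₁.tonelli.aemeasurable_energyDensity g (P.rect n))).ennreal_ofReal).const_mul _
  exact key.trans_lt (ENNReal.add_lt_top.2
    ⟨ENNReal.mul_lt_top ENNReal.ofReal_lt_top (hf₁.dirichlet_lt_top P),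
      ENNReal.mul_lt_top ENNReal.ofReal_lt_top (hf₂.dirichlet_lt_top P)⟩)

theorem IsRoyden.const (g : Metric m R) (c : ℝ) : IsRoyden g fun _ : R => c := by
  have hp : ∀ (i : Fin m) (T : CoordRectangle m R),
      partialDeriv i ((fun _ : R => c) ∘ T.chart.symm) = 0 := by
    intro i T
    ext x
    simp [partialDeriv, lineDeriv]
  refine ⟨continuous_const, ⟨|c|, fun _ => le_rfl⟩, fun T => ⟨continuousOn_const, ?_, ?_, ?_⟩, ?_⟩
  · refine fun i => ae_of_all _ fun x a _ b _ => ?_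
    exact ((LipschitzWith.const c).lipschitzOnWith).absolutelyContinuousOnInterval
  · refine fun i => ae_of_all _ fun x => ?_
    exact differentiableAt_const c
  · intro i K _ _
    rw [hp]
    exact MemLp.zero
  · intro P
    simp [dirichletIntegral, energyDensity, hp]

theorem ae_hasLineDerivAt {F : EuclideanSpace ℝ (Fin m) → ℝ} {a b : Fin m → ℝ}
    (hF : IsTonelliOn a b F) (i : Fin m) :
    ∀ᵐ x ∂(volume.restrict {x : EuclideanSpace ℝ (Fin m) | ∀ i, x i ∈ Set.Ioo (a i) (b i)}),
      HasLineDerivAt ℝ F (partialDeriv i F x) x (EuclideanSpace.single i 1) :=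
  (hF.ae_hasPartial i).mono fun _ hx => hx.hasLineDerivAt

theorem hasLineDerivAt_mul {F H : EuclideanSpace ℝ (Fin m) → ℝ} {F' H' : ℝ}
    {x v : EuclideanSpace ℝ (Fin m)} (hF : HasLineDerivAt ℝ F F' x v)
    (hH : HasLineDerivAt ℝ H H' x v) :
    HasLineDerivAt ℝ (F * H) (H x * F' + F x * H') x v := by
  have := HasDerivAt.mul hF hH
  unfold HasLineDerivAt
  convert! this using 1
  simp
  ring

theorem hasLineDerivAt_add {F H : EuclideanSpace ℝ (Fin m) → ℝ} {F' H' : ℝ}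
    {x v : EuclideanSpace ℝ (Fin m)} (hF : HasLineDerivAt ℝ F F' x v)
    (hH : HasLineDerivAt ℝ H H' x v) :
    HasLineDerivAt ℝ (F + H) (F' + H') x v :=
  HasDerivAt.add hF hH

theorem measurableSet_box (a b : Fin m → ℝ) :
    MeasurableSet {x : EuclideanSpace ℝ (Fin m) | ∀ i, x i ∈ Set.Ioo (a i) (b i)} := by
  have : {x : EuclideanSpace ℝ (Fin m) | ∀ i, x i ∈ Set.Ioo (a i) (b i)} =
      ⋂ i, (fun x : EuclideanSpace ℝ (Fin m) => x i) ⁻¹' Set.Ioo (a i) (b i) := by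
    ext; simp
  rw [this]
  exact MeasurableSet.iInter fun i => measurableSet_Ioo.preimage (by fun_prop)

theorem IsTonelliOn.add {F H : EuclideanSpace ℝ (Fin m) → ℝ} {a b : Fin m → ℝ}
    (hF : IsTonelliOn a b F) (hH : IsTonelliOn a b H) : IsTonelliOn a b (F + H) where
  continuousOn := hF.continuousOn.add hH.continuousOn
  ae_absolutelyContinuous i := by
    filter_upwards [hF.ae_absolutelyContinuous i, hH.ae_absolutelyContinuous i] with x h1 h2
    exact fun c hc d hd => (h1 c hc d hd).add (h2 c hc d hd)
  ae_hasPartial i := by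
    filter_upwards [ae_hasLineDerivAt hF i, ae_hasLineDerivAt hH i] with x h1 h2
    exact (hasLineDerivAt_add h1 h2).lineDifferentiableAt
  memLp_partial i K hK hKU := by
    refine ((hF.memLp_partial i K hK hKU).add (hH.memLp_partial i K hK hKU)).ae_eq ?_
    filter_upwards [ae_mono (Measure.restrict_mono hKU le_rfl) (ae_hasLineDerivAt hF i),
      ae_mono (Measure.restrict_mono hKU le_rfl) (ae_hasLineDerivAt hH i)] with x h1 h2
    exact (hasLineDerivAt_add h1 h2).lineDeriv.symm

theorem memLp_continuousOn_mul {F H : EuclideanSpace ℝ (Fin m) → ℝ}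
    {K : Set (EuclideanSpace ℝ (Fin m))} (hK : IsCompact K) (hF : ContinuousOn F K)
    (hH : MemLp H 2 (volume.restrict K)) :
    MemLp (fun x => F x * H x) 2 (volume.restrict K) := by
  obtain ⟨C, hC⟩ := hK.exists_bound_of_continuousOn hF
  have : MemLp F ⊤ (volume.restrict K) :=
    memLp_top_of_bound (hF.aestronglyMeasurable hK.measurableSet) C
      ((ae_restrict_iff' hK.measurableSet).2 (ae_of_all _ hC))
  exact hH.mul' this

theorem IsTonelliOn.mul {F H : EuclideanSpace ℝ (Fin m) → ℝ} {a b : Fin m → ℝ}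
    (hF : IsTonelliOn a b F) (hH : IsTonelliOn a b H) : IsTonelliOn a b (F * H) where
  continuousOn := hF.continuousOn.mul hH.continuousOn
  ae_absolutelyContinuous i := by
    filter_upwards [hF.ae_absolutelyContinuous i, hH.ae_absolutelyContinuous i] with x h1 h2
    exact fun c hc d hd => (h1 c hc d hd).mul (h2 c hc d hd)
  ae_hasPartial i := by
    filter_upwards [ae_hasLineDerivAt hF i, ae_hasLineDerivAt hH i] with x h1 h2
    exact (hasLineDerivAt_mul h1 h2).lineDifferentiableAt
  memLp_partial i K hK hKU := by
    refine ((memLp_continuousOn_mul hK (hH.continuousOn.mono hKU)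
      (hF.memLp_partial i K hK hKU)).add (memLp_continuousOn_mul hK (hF.continuousOn.mono hKU)
      (hH.memLp_partial i K hK hKU))).ae_eq ?_
    filter_upwards [ae_mono (Measure.restrict_mono hKU le_rfl) (ae_hasLineDerivAt hF i),
      ae_mono (Measure.restrict_mono hKU le_rfl) (ae_hasLineDerivAt hH i)] with x h1 h2
    exact (hasLineDerivAt_mul h1 h2).lineDeriv.symm

theorem IsRoyden.add {g : Metric m R} {f h : R → ℝ} (hf : IsRoyden g f) (hh : IsRoyden g h) :
    IsRoyden g (f + h) where
  continuous := hf.continuous.add hh.continuous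
  bounded := by
    obtain ⟨C, hC⟩ := hf.bounded
    obtain ⟨D, hD⟩ := hh.bounded
    exact ⟨C + D, fun p => (abs_add_le _ _).trans (add_le_add (hC p) (hD p))⟩
  tonelli T := (hf.tonelli T).add (hh.tonelli T)
  dirichlet_lt_top := by
    refine dirichletIntegral_lt_top_of_combination g (α := fun _ => 1) (β := fun _ => 1) (C := 1)
      hf hh (by simp) (by simp) fun T => ?_
    rw [T.target_eq, ae_all_iff]
    intro i
    filter_upwards [ae_hasLineDerivAt (hf.tonelli T) i, ae_hasLineDerivAt (hh.tonelli T) i]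
      with x h1 h2
    rw [one_mul, one_mul]
    exact (hasLineDerivAt_add h1 h2).lineDeriv

theorem IsRoyden.mul {g : Metric m R} {f h : R → ℝ} (hf : IsRoyden g f) (hh : IsRoyden g h) :
    IsRoyden g (f * h) where
  continuous := hf.continuous.mul hh.continuous
  bounded := by
    obtain ⟨C, hC⟩ := hf.bounded
    obtain ⟨D, hD⟩ := hh.bounded
    refine ⟨C * D, fun p => ?_⟩
    rw [Pi.mul_apply, abs_mul]
    exact mul_le_mul (hC p) (hD p) (abs_nonneg _) ((abs_nonneg _).trans (hC p))
  tonelli T := (hf.tonelli T).mul (hh.tonelli T)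
  dirichlet_lt_top := by
    obtain ⟨C, hC⟩ := hf.bounded
    obtain ⟨D, hD⟩ := hh.bounded
    refine dirichletIntegral_lt_top_of_combination g (α := h) (β := f) (C := max C D)
      hf hh (fun p => (hD p).trans (le_max_right _ _)) (fun p => (hC p).trans (le_max_left _ _))
      fun T => ?_
    rw [T.target_eq, ae_all_iff]
    intro i
    filter_upwards [ae_hasLineDerivAt (hf.tonelli T) i, ae_hasLineDerivAt (hh.tonelli T) i]
      with x h1 h2
    exact (hasLineDerivAt_mul h1 h2).lineDeriv

/-- The Royden algebra `M(R)`, as a subalgebra of the algebra of all real functions on `R`. -/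
def algebra (g : Metric m R) : Subalgebra ℝ (R → ℝ) where
  carrier := {f | IsRoyden g f}
  mul_mem' hf hh := hf.mul hh
  add_mem' hf hh := hf.add hh
  algebraMap_mem' c := IsRoyden.const g c

/-- The characters of the Royden algebra: the (unital) multiplicative linear functionals
`M(R) → ℝ`. -/
def Character (g : Metric m R) : Type _ := algebra g →ₐ[ℝ] ℝ

/-- The value `χ(f)` of a character. -/
def Character.eval {g : Metric m R} (χ : Character g) (f : algebra g) : ℝ :=
  (show algebra g →ₐ[ℝ] ℝ from χ) f

/-- The weak-* topology on characters: the coarsest topology making all the evaluations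
`χ ↦ χ(f)`, `f ∈ M(R)`, continuous. -/
instance (g : Metric m R) : TopologicalSpace (Character g) :=
  ⨅ f : algebra g, TopologicalSpace.induced (fun χ : Character g => χ.eval f) inferInstance

/-- The character `f ↦ f(p)` of evaluation at a point `p ∈ R`. -/
def pointCharacter (g : Metric m R) (p : R) : Character g :=
  (Pi.evalAlgHom ℝ (fun _ : R => ℝ) p).comp (algebra g).val

/-- `ι : R → X` exhibits `X` as a Royden compactification of `R`: `X` is a compact Hausdorff space,
`ι` identifies `R` with an open dense subspace of `X`, every function in `M(R)` extends to a
continuous function on `X`, and these extensions separate the points of `X`. -/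
structure IsCompactification (g : Metric m R) {X : Type*} [TopologicalSpace X] (ι : R → X) :
    Prop where
  compactSpace : CompactSpace X
  t2Space : T2Space X
  isOpenEmbedding : Topology.IsOpenEmbedding ι
  denseRange : DenseRange ι
  exists_extension : ∀ f ∈ algebra g, ∃ F : X → ℝ, Continuous F ∧ ∀ p, F (ι p) = f p
  separates : ∀ x y : X, x ≠ y → ∃ f ∈ algebra g, ∃ F : X → ℝ,
    Continuous F ∧ (∀ p, F (ι p) = f p) ∧ F x ≠ F y

end Manifold

end Royden

end

/-!
The theorem has an analytic half and a topological half.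

*Analysis.* Two facts about the Royden algebra `M(R)` are needed beyond its being an algebra.
First, `M(R)` is closed under inversion of functions bounded below by a positive constant
(`IsRoyden.inv`): `1 / h` is the composition of `h` with a function Lipschitz on the range of `h`,
so absolute continuity on segments is preserved, and `∂(1 / h) = - h⁻² ∂h` is controlled by `∂h`.
Second, `M(R)` contains the compactly supported smooth functions
(`IsRoyden.of_contMDiff_of_hasCompactSupport`): the support of such a function meets only finitely
many members of a partition of unity, and the energy density is continuous in coordinates because
the Gram matrix of the metric is positive definite there.

*Topology.* Closure under inversion says that a character vanishes on no function bounded below by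
a positive constant (`Character.eval_ne_zero`). Hence characters are positive, so `|χ f| ≤ sup |f|`,
and the characters form a closed subset of a product of compact intervals. Moreover, applied to
`∑ (fᵢ - χ(fᵢ))²`, it says that `χ` is approximated on finitely many functions by a point evaluation,
so the points of `R` are dense. If `f ∈ M(R)` has compact support `K`, then density forces a
character with `χ(f) ≠ 0` to lie in the closed set of point evaluations on `K`; with bump
functions for `f`, this makes `R` an open subspace.

Conversely, evaluating continuous extensions maps any Royden compactification continuously to the
characters; the map is injective because the extensions separate points, and surjective because its
range is compact and contains the dense set of point evaluations.
-/

noncomputable section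

namespace Royden

/-! ### Inversion in the Royden algebra -/

section Inversion

variable {m : ℕ}

/-- Inversion preserves absolute continuity away from zero, as it is Lipschitz on `[c, ∞)` with
constant `c⁻²`. -/
theorem absolutelyContinuousOnInterval_inv {φ : ℝ → ℝ} {a b c : ℝ} (hc : 0 < c)
    (hφ : AbsolutelyContinuousOnInterval φ a b) (hcφ : ∀ z ∈ Set.uIcc a b, c ≤ φ z) :
    AbsolutelyContinuousOnInterval (fun z => (φ z)⁻¹) a b := by
  rw [absolutelyContinuousOnInterval_iff] at hφ ⊢
  intro ε hε
  obtain ⟨δ, hδ, H⟩ := hφ (c ^ 2 * ε) (by positivity)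
  refine ⟨δ, hδ, fun E hE hlen => ?_⟩
  have hsum : c ^ 2 * ∑ i ∈ Finset.range E.1, dist (φ (E.2 i).1)⁻¹ (φ (E.2 i).2)⁻¹ ≤
      ∑ i ∈ Finset.range E.1, dist (φ (E.2 i).1) (φ (E.2 i).2) := by
    rw [Finset.mul_sum]
    refine Finset.sum_le_sum fun i hi => ?_
    have h1 := hcφ _ (hE.1 i hi).1
    have h2 := hcφ _ (hE.1 i hi).2
    have p1 : 0 < φ (E.2 i).1 := hc.trans_le h1
    have p2 : 0 < φ (E.2 i).2 := hc.trans_le h2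
    rw [dist_inv_inv₀ p1.ne' p2.ne', Real.norm_of_nonneg p1.le, Real.norm_of_nonneg p2.le,
      ← mul_div_assoc, div_le_iff₀ (by positivity), mul_comm]
    refine mul_le_mul_of_nonneg_left ?_ dist_nonneg
    nlinarith
  exact lt_of_mul_lt_mul_left (hsum.trans_lt (H E hE hlen)) (by positivity)

theorem hasLineDerivAt_inv {F : EuclideanSpace ℝ (Fin m) → ℝ} {F' : ℝ}
    {x v : EuclideanSpace ℝ (Fin m)} (hF : HasLineDerivAt ℝ F F' x v) (hx : F x ≠ 0) :
    HasLineDerivAt ℝ (fun y => (F y)⁻¹) (-(F x ^ 2)⁻¹ * F') x v := by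
  have := HasDerivAt.inv hF (by simpa using hx)
  unfold HasLineDerivAt
  convert! this using 1
  simp
  ring

theorem IsTonelliOn.inv {F : EuclideanSpace ℝ (Fin m) → ℝ} {a b : Fin m → ℝ} {c : ℝ} (hc : 0 < c)
    (hF : IsTonelliOn a b F) (hcF : ∀ x, c ≤ F x) : IsTonelliOn a b fun x => (F x)⁻¹ where
  continuousOn := hF.continuousOn.inv₀ fun x _ => (hc.trans_le (hcF x)).ne'
  ae_absolutelyContinuous i := by
    filter_upwards [hF.ae_absolutelyContinuous i] with x hx
    exact fun s hs t ht => absolutelyContinuousOnInterval_inv hc (hx s hs t ht) fun _ _ => hcF _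
  ae_hasPartial i := by
    filter_upwards [ae_hasLineDerivAt hF i] with x hx
    exact (hasLineDerivAt_inv hx (hc.trans_le (hcF x)).ne').lineDifferentiableAt
  memLp_partial i K hK hKU := by
    have hcont : ContinuousOn (fun x => -(F x ^ 2)⁻¹) K :=
      (((hF.continuousOn.mono hKU).pow 2).inv₀ fun x _ =>
        pow_ne_zero 2 (hc.trans_le (hcF x)).ne').neg
    refine (memLp_continuousOn_mul hK hcont (hF.memLp_partial i K hK hKU)).ae_eq ?_
    filter_upwards [ae_mono (Measure.restrict_mono hKU le_rfl) (ae_hasLineDerivAt hF i)] with x hx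
    exact (hasLineDerivAt_inv hx (hc.trans_le (hcF x)).ne').lineDeriv.symm

variable {R : Type*} [TopologicalSpace R] [ChartedSpace (EuclideanSpace ℝ (Fin m)) R]
  [IsManifold (𝓡 m) ∞ R]

/-- The Royden algebra is inverse closed: a function in it that is bounded below by a positive
constant has its inverse in it. -/
theorem IsRoyden.inv {g : Metric m R} {f : R → ℝ} {c : ℝ} (hc : 0 < c) (hf : IsRoyden g f)
    (hcf : ∀ p, c ≤ f p) : IsRoyden g fun p => (f p)⁻¹ where
  continuous := hf.continuous.inv₀ fun p => (hc.trans_le (hcf p)).ne'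
  bounded := by
    refine ⟨c⁻¹, fun p => ?_⟩
    rw [abs_of_pos (inv_pos.2 (hc.trans_le (hcf p)))]
    exact inv_anti₀ hc (hcf p)
  tonelli T := (hf.tonelli T).inv hc fun x => hcf _
  dirichlet_lt_top := by
    refine dirichletIntegral_lt_top_of_combination g (α := fun p => -(f p ^ 2)⁻¹)
      (β := fun _ => 0) (C := (c ^ 2)⁻¹) hf hf (fun p => ?_) (fun p => ?_) fun T => ?_
    · have := hcf p
      rw [abs_neg, abs_of_nonneg (by positivity)]
      exact inv_anti₀ (by positivity) (pow_le_pow_left₀ hc.le this 2)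
    · rw [abs_zero]
      positivity
    · rw [T.target_eq, ae_all_iff]
      intro i
      filter_upwards [ae_hasLineDerivAt (hf.tonelli T) i] with x hx
      rw [zero_mul, add_zero]
      exact (hasLineDerivAt_inv hx (hc.trans_le (hcf _)).ne').lineDeriv

end Inversion

/-! ### Compactly supported smooth functions -/

section SmoothFunctions

variable {m : ℕ}

theorem isOpen_box (a b : Fin m → ℝ) :
    IsOpen {x : EuclideanSpace ℝ (Fin m) | ∀ i, x i ∈ Set.Ioo (a i) (b i)} := by
  simp only [Set.ofPred_forall]
  exact isOpen_iInter_of_finite fun i =>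
    isOpen_Ioo.preimage (f := fun x : EuclideanSpace ℝ (Fin m) => x i) (by fun_prop)

theorem continuousOn_partialDeriv {F : EuclideanSpace ℝ (Fin m) → ℝ}
    {U : Set (EuclideanSpace ℝ (Fin m))} (hU : IsOpen U) (hF : ContDiffOn ℝ 1 F U) (i : Fin m) :
    ContinuousOn (partialDeriv i F) U :=
  ((hF.continuousOn_fderiv_of_isOpen hU le_rfl).clm_apply continuousOn_const).congr fun _ hx =>
    ((hF.differentiableOn one_ne_zero).differentiableAt (hU.mem_nhds hx)).lineDeriv_eq_fderiv

/-- Continuously differentiable functions are Tonelli functions: they are locally Lipschitz on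
segments. -/
theorem IsTonelliOn.of_contDiffOn {F : EuclideanSpace ℝ (Fin m) → ℝ} {a b : Fin m → ℝ}
    (hF : ContDiffOn ℝ 1 F {x | ∀ i, x i ∈ Set.Ioo (a i) (b i)}) : IsTonelliOn a b F where
  continuousOn := hF.continuousOn
  ae_absolutelyContinuous i := by
    refine (ae_restrict_iff' (measurableSet_box a b)).2 (ae_of_all _ fun x hx s hs t ht => ?_)
    have hloc : LocallyLipschitzOn (Set.uIcc s t)
        fun z : ℝ => F (WithLp.toLp 2 (Function.update x.ofLp i z)) := by
      intro z hz
      have hz' : z ∈ Set.Ioo (a i) (b i) := Set.ordConnected_Ioo.uIcc_subset hs ht hz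
      have hmem : (WithLp.toLp 2 (Function.update x.ofLp i z) : EuclideanSpace ℝ (Fin m)) ∈
          {x : EuclideanSpace ℝ (Fin m) | ∀ i, x i ∈ Set.Ioo (a i) (b i)} := by
        intro j
        rcases eq_or_ne j i with rfl | hj
        · simpa using hz'
        · simpa [hj] using hx j
      have h1 : ContDiffAt ℝ 1 F (WithLp.toLp 2 (Function.update x.ofLp i z)) :=
        hF.contDiffAt ((isOpen_box a b).mem_nhds hmem)
      have h2 : ContDiff ℝ 1 fun z : ℝ =>
          (WithLp.toLp 2 (Function.update x.ofLp i z) : EuclideanSpace ℝ (Fin m)) :=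
        (PiLp.contDiff_toLp (𝕜 := ℝ) (p := 2) (n := 1) (E := fun _ : Fin m => ℝ)).comp
          (contDiff_update 1 x.ofLp i)
      obtain ⟨K, V, hV, hK⟩ := (h1.comp z h2.contDiffAt).exists_lipschitzOnWith
      exact ⟨K, V, mem_nhdsWithin_of_mem_nhds hV, hK⟩
    obtain ⟨K, hK⟩ := hloc.exists_lipschitzOnWith_of_compact isCompact_uIcc
    exact hK.absolutelyContinuousOnInterval
  ae_hasPartial i :=
    (ae_restrict_iff' (measurableSet_box a b)).2 (ae_of_all _ fun _ hx =>
      ((hF.differentiableOn one_ne_zero).differentiableAt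
        ((isOpen_box a b).mem_nhds hx)).lineDifferentiableAt)
  memLp_partial i K hK hKU := by
    have := memLp_continuousOn_mul (H := fun _ => 1) hK
      ((continuousOn_partialDeriv (isOpen_box a b) hF i).mono hKU)
      (have : IsFiniteMeasure (volume.restrict K) := isFiniteMeasure_restrict.2 hK.measure_lt_top.ne
       memLp_const 1)
    simpa using this

variable {R : Type*} [TopologicalSpace R] [ChartedSpace (EuclideanSpace ℝ (Fin m)) R]

theorem contDiffOn_comp_symm {f : R → ℝ} (hf : ContMDiff (𝓡 m) 𝓘(ℝ) ∞ f) (T : CoordRectangle m R) :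
    ContDiffOn ℝ 1 (f ∘ T.chart.symm) T.chart.target := by
  have h : ContMDiffOn (𝓡 m) 𝓘(ℝ) ∞ (f ∘ T.chart.symm) T.chart.target :=
    hf.comp_contMDiffOn (contMDiffOn_symm_of_mem_maximalAtlas T.chart_mem)
  exact (contMDiffOn_iff_contDiffOn.1 h).of_le (by simp)

variable [IsManifold (𝓡 m) ∞ R]

/-- The coordinate vector fields are linearly independent, being the images of the standard basis
under the differential of a diffeomorphism. -/
theorem det_gramMatrix_pos (g : Metric m R) (T : CoordRectangle m R)
    {x : EuclideanSpace ℝ (Fin m)} (hx : x ∈ T.chart.target) : 0 < (gramMatrix g T x).det := by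
  have hT : T.chart.MDifferentiable (𝓡 m) (𝓡 m) :=
    ⟨(contMDiffOn_of_mem_maximalAtlas T.chart_mem).mdifferentiableOn (by simp),
      (contMDiffOn_symm_of_mem_maximalAtlas T.chart_mem).mdifferentiableOn (by simp)⟩
  refine (Matrix.PosDef.of_dotProduct_mulVec_pos (posSemidef_gramMatrix g T x).1
    fun c hc => ?_).det_pos
  have h : star c ⬝ᵥ (gramMatrix g T x).mulVec c =
      g.inner (T.chart.symm x) (∑ i, c i • T.coordVector i x) (∑ i, c i • T.coordVector i x) := by
    simp [gramMatrix, dotProduct, Matrix.mulVec, Finset.mul_sum, map_sum]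
    refine Finset.sum_congr rfl fun i _ => Finset.sum_congr rfl fun j _ => ?_
    rw [g.symm _ (T.coordVector i x)]
    ring
  rw [h]
  refine g.pos _ _ fun h0 => hc ?_
  let A : EuclideanSpace ℝ (Fin m) →L[ℝ] TangentSpace (𝓡 m) (T.chart.symm x) :=
    mfderiv (𝓡 m) (𝓡 m) T.chart.symm x
  have hsum : A (∑ i, c i • EuclideanSpace.single i (1 : ℝ)) = A 0 := by
    rw [map_sum, map_zero, ← h0]
    exact Finset.sum_congr rfl fun i _ => map_smul A _ _
  have hinj : Function.Injective A := hT.symm.mfderiv_injective hx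
  have hzero := hinj hsum
  ext j
  have := congrArg (fun v : EuclideanSpace ℝ (Fin m) => v j) hzero
  simpa [Pi.single_apply] using this

theorem continuousOn_energyDensity (g : Metric m R) (T : CoordRectangle m R) {f : R → ℝ}
    (hf : ContMDiff (𝓡 m) 𝓘(ℝ) ∞ f) : ContinuousOn (energyDensity g T f) T.chart.target := by
  have hG : ContinuousOn (gramMatrix g T) T.chart.target :=
    continuousOn_pi.2 fun i => continuousOn_pi.2 fun j => continuousOn_gramMatrix g T i j
  have hdet : ContinuousOn (fun x => (gramMatrix g T x).det) T.chart.target :=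
    (continuous_id.matrix_det).comp_continuousOn hG
  have hinv : ∀ i j, ContinuousOn (fun x => (gramMatrix g T x)⁻¹ i j) T.chart.target := by
    intro i j
    have hadj : ContinuousOn (fun x => (gramMatrix g T x).adjugate i j) T.chart.target :=
      (continuous_id.matrix_adjugate.matrix_elem i j).comp_continuousOn hG
    refine ((hdet.inv₀ fun x hx => (det_gramMatrix_pos g T hx).ne').mul hadj).congr fun x _ => ?_
    simp [Matrix.inv_def]
  have hp := fun i => continuousOn_partialDeriv T.chart.open_target (contDiffOn_comp_symm hf T) i
  exact (continuousOn_finsetSum _ fun i _ => continuousOn_finsetSum _ fun j _ =>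
    ((hinv i j).mul (hp i)).mul (hp j)).mul hdet.sqrt

theorem energyDensity_eq_zero (g : Metric m R) (T : CoordRectangle m R) {f : R → ℝ}
    {x : EuclideanSpace ℝ (Fin m)} (hx : x ∈ T.chart.target) (hfx : T.chart.symm x ∉ tsupport f) :
    energyDensity g T f x = 0 := by
  have h0 : f ∘ T.chart.symm =ᶠ[nhds x] fun _ => 0 :=
    (T.chart.symm.continuousAt hx).eventually (notMem_tsupport_iff_eventuallyEq.1 hfx)
  have hp : ∀ i, partialDeriv i (f ∘ T.chart.symm) x = 0 := fun i => by
    rw [partialDeriv, h0.lineDeriv_eq]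
    simp [lineDeriv]
  simp [energyDensity, hp]

/-- A compactly supported smooth function has finite Dirichlet integral: its support meets the
supports of finitely many members of the partition only, and each of these contributes the integral
over a compact set of a continuous function. -/
theorem dirichletIntegral_lt_top_of_hasCompactSupport (g : Metric m R) {f : R → ℝ}
    (hf : ContMDiff (𝓡 m) 𝓘(ℝ) ∞ f) (hs : HasCompactSupport f) (P : RectPartition m R) :
    dirichletIntegral g P f < ⊤ := by
  have hfin := P.toPartition.locallyFinite.finite_nonempty_inter_compact hs
  unfold dirichletIntegral
  rw [tsum_eq_sum (s := hfin.toFinset), ENNReal.sum_lt_top]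
  · intro n _
    set T := P.rect n
    set h : EuclideanSpace ℝ (Fin m) → ℝ := fun x =>
      P.toPartition n (T.chart.symm x) * energyDensity g T f x with hh
    have hcont : ContinuousOn h T.chart.target :=
      ((P.toPartition n).contMDiff.continuous.comp_continuousOn T.chart.continuousOn_symm).mul
        (continuousOn_energyDensity g T hf)
    set K : Set (EuclideanSpace ℝ (Fin m)) :=
      T.chart '' (tsupport f ∩ tsupport (P.toPartition n))
    have hsub : tsupport f ∩ tsupport (P.toPartition n) ⊆ T.chart.source :=
      Set.inter_subset_right.trans (P.subordinate n)
    have hK : IsCompact K :=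
      (hs.isCompact.inter_right (isClosed_tsupport _)).image_of_continuousOn
        (T.chart.continuousOn.mono hsub)
    have hKT : K ⊆ T.chart.target := by
      rintro _ ⟨p, hp, rfl⟩
      exact T.chart.map_source (hsub hp)
    obtain ⟨C, hC⟩ := hK.exists_bound_of_continuousOn (hcont.mono hKT)
    calc ∫⁻ x in T.chart.target, ENNReal.ofReal (h x)
        ≤ ∫⁻ x in T.chart.target, K.indicator (fun _ => ENNReal.ofReal C) x := by
          refine setLIntegral_mono' T.chart.open_target.measurableSet fun x hx => ?_
          by_cases hxK : x ∈ K
          · rw [Set.indicator_of_mem hxK]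
            exact ENNReal.ofReal_le_ofReal ((le_abs_self _).trans (hC x hxK))
          · have : h x = 0 := by
              by_contra hne
              refine hxK ⟨T.chart.symm x, ⟨?_, ?_⟩, T.chart.right_inv hx⟩
              · by_contra hnot
                exact hne (by simp [hh, energyDensity_eq_zero g T hx hnot])
              · exact subset_tsupport _ (left_ne_zero_of_mul hne)
            simp [this]
      _ ≤ ∫⁻ x, K.indicator (fun _ => ENNReal.ofReal C) x := setLIntegral_le_lintegral _ _
      _ = ENNReal.ofReal C * volume K := lintegral_indicator_const hK.measurableSet _
      _ < ⊤ := ENNReal.mul_lt_top ENNReal.ofReal_lt_top hK.measure_lt_top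
  · intro n hn
    rw [setLIntegral_congr_fun (g := 0) (P.rect n).chart.open_target.measurableSet]
    · simp
    · intro x hx
      by_cases hfx : (P.rect n).chart.symm x ∈ tsupport f
      · have : P.toPartition n ((P.rect n).chart.symm x) = 0 := by
          by_contra hne
          exact hn (hfin.mem_toFinset.2 ⟨_, hne, hfx⟩)
        simp [this]
      · simp [energyDensity_eq_zero g _ hx hfx]

theorem IsRoyden.of_contMDiff_of_hasCompactSupport (g : Metric m R) {f : R → ℝ}
    (hf : ContMDiff (𝓡 m) 𝓘(ℝ) ∞ f) (hs : HasCompactSupport f) : IsRoyden g f where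
  continuous := hf.continuous
  bounded := hs.exists_bound_of_continuous hf.continuous
  tonelli T := IsTonelliOn.of_contDiffOn (T.target_eq ▸ contDiffOn_comp_symm hf T)
  dirichlet_lt_top := dirichletIntegral_lt_top_of_hasCompactSupport g hf hs

/-- Every neighbourhood of a point carries a compactly supported function of the Royden algebra
that does not vanish at the point. -/
theorem exists_mem_algebra_tsupport_subset [T2Space R] (g : Metric m R) {p : R} {U : Set R}
    (hU : U ∈ nhds p) : ∃ f ∈ algebra g, HasCompactSupport f ∧ tsupport f ⊆ U ∧ f p ≠ 0 := by
  obtain ⟨f, -, hf⟩ := (SmoothBumpFunction.nhds_basis_tsupport (I := 𝓡 m) p).mem_iff.1 hU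
  exact ⟨f, IsRoyden.of_contMDiff_of_hasCompactSupport g f.contMDiff f.hasCompactSupport,
    f.hasCompactSupport, hf, by simp⟩

end SmoothFunctions

/-! ### The space of characters -/

section Characters

variable {m : ℕ} {R : Type*} [TopologicalSpace R] [ChartedSpace (EuclideanSpace ℝ (Fin m)) R]
  [IsManifold (𝓡 m) ∞ R] {g : Metric m R}

namespace Character

/-- The underlying algebra homomorphism of a character. -/
def toAlgHom (χ : Character g) : algebra g →ₐ[ℝ] ℝ := χ

theorem eval_eq (χ : Character g) (f : algebra g) : χ.eval f = χ.toAlgHom f := rfl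

@[ext]
theorem ext {χ ψ : Character g} (h : ∀ f, χ.eval f = ψ.eval f) : χ = ψ :=
  AlgHom.ext (φ₁ := χ.toAlgHom) (φ₂ := ψ.toAlgHom) h

/-- The topology of the space of characters is that of pointwise convergence. -/
theorem isInducing_eval : Topology.IsInducing (eval : Character g → algebra g → ℝ) := by
  refine ⟨?_⟩
  simp only [Pi.topologicalSpace, induced_iInf, induced_compose]
  rfl

theorem isEmbedding_eval : Topology.IsEmbedding (eval : Character g → algebra g → ℝ) :=
  ⟨isInducing_eval, fun _ _ h => ext (congrFun h)⟩

theorem continuous_eval (f : algebra g) : Continuous fun χ : Character g => χ.eval f :=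
  (continuous_apply f).comp isInducing_eval.continuous

theorem continuous_iff {X : Type*} [TopologicalSpace X] {σ : X → Character g} :
    Continuous σ ↔ ∀ f, Continuous fun x => (σ x).eval f :=
  isInducing_eval.continuous_iff.trans continuous_pi_iff

instance : T2Space (Character g) := isEmbedding_eval.t2Space

/-- A character does not vanish on functions bounded below by a positive constant, as these are
invertible in the Royden algebra. -/
theorem eval_ne_zero (χ : Character g) {f : algebra g} {c : ℝ} (hc : 0 < c)
    (hf : ∀ p, c ≤ f.1 p) : χ.eval f ≠ 0 := by
  let k : algebra g := ⟨fun p => (f.1 p)⁻¹, IsRoyden.inv hc f.2 hf⟩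
  have hfk : f * k = 1 := Subtype.ext (funext fun p => mul_inv_cancel₀ (hc.trans_le (hf p)).ne')
  have h := congrArg χ.toAlgHom hfk
  rw [map_mul, map_one] at h
  exact left_ne_zero_of_mul_eq_one h

theorem eval_nonneg (χ : Character g) {f : algebra g} (hf : ∀ p, 0 ≤ f.1 p) : 0 ≤ χ.eval f := by
  by_contra! hneg
  refine χ.eval_ne_zero (f := f - algebraMap ℝ _ (χ.eval f)) (neg_pos.2 hneg) (fun p => ?_) ?_
  · change -χ.eval f ≤ f.1 p - χ.eval f
    linarith [hf p]
  · rw [eval_eq, map_sub, AlgHom.commutes]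
    exact sub_self _

theorem abs_eval_le (χ : Character g) {f : algebra g} {C : ℝ} (hC : ∀ p, |f.1 p| ≤ C) :
    |χ.eval f| ≤ C := by
  have h1 := χ.eval_nonneg (f := algebraMap ℝ _ C - f) fun p =>
    sub_nonneg.2 (abs_le.1 (hC p)).2
  have h2 := χ.eval_nonneg (f := f - algebraMap ℝ _ (-C)) fun p =>
    sub_nonneg.2 (abs_le.1 (hC p)).1
  rw [eval_eq, map_sub, AlgHom.commutes] at h1 h2
  exact abs_le.2 ⟨sub_nonneg.1 h2, sub_nonneg.1 h1⟩

theorem isClosed_range_eval : IsClosed (Set.range (eval : Character g → algebra g → ℝ)) := by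
  have : Set.range (eval : Character g → algebra g → ℝ) =
      {ψ | (∀ r : ℝ, ψ (algebraMap ℝ _ r) = r) ∧ (∀ f k, ψ (f + k) = ψ f + ψ k) ∧
        ∀ f k, ψ (f * k) = ψ f * ψ k} := by
    ext ψ
    constructor
    · rintro ⟨χ, rfl⟩
      exact ⟨χ.toAlgHom.commutes, map_add χ.toAlgHom, map_mul χ.toAlgHom⟩
    · rintro ⟨h1, h2, h3⟩
      let A : algebra g →ₐ[ℝ] ℝ :=
        { toFun := ψ
          map_one' := by simpa using h1 1
          map_mul' := h3
          map_zero' := by simpa using h1 0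
          map_add' := h2
          commutes' := h1 }
      exact ⟨A, rfl⟩
  rw [this]
  simp only [Set.ofPred_and, Set.ofPred_forall]
  refine .inter (isClosed_iInter fun r => ?_) (.inter (isClosed_iInter fun f => isClosed_iInter
    fun k => ?_) (isClosed_iInter fun f => isClosed_iInter fun k => ?_))
  all_goals exact isClosed_eq (by fun_prop) (by fun_prop)

instance : CompactSpace (Character g) := by
  choose C hC using fun f : algebra g => IsRoyden.bounded f.2
  have hcpt : IsCompact (Set.range (eval : Character g → algebra g → ℝ)) := by
    refine (isCompact_univ_pi fun f => isCompact_Icc (a := -C f) (b := C f)).of_isClosed_subset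
      isClosed_range_eval ?_
    rintro _ ⟨χ, rfl⟩ f -
    exact abs_le.1 (χ.abs_eval_le (hC f))
  rw [← Set.image_univ] at hcpt
  exact ⟨isInducing_eval.isCompact_iff.2 hcpt⟩

/-- On finitely many functions, a character is approximated by point evaluations: otherwise
`∑ (f - χ(f))²`, on which `χ` vanishes, would be bounded below by a positive constant. -/
theorem exists_abs_sub_eval_lt (χ : Character g) (s : Finset (algebra g)) {ε : ℝ} (hε : 0 < ε) :
    ∃ p : R, ∀ f ∈ s, |f.1 p - χ.eval f| < ε := by
  let k : algebra g := ∑ f ∈ s, (f - algebraMap ℝ _ (χ.eval f)) ^ 2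
  have hk : ∀ p, k.1 p = ∑ f ∈ s, (f.1 p - χ.eval f) ^ 2 := by
    intro p
    change (Pi.evalAlgHom ℝ (fun _ : R => ℝ) p).comp (algebra g).val k = _
    rw [map_sum]
    rfl
  have hχk : χ.eval k = 0 := by
    rw [eval_eq, map_sum]
    refine Finset.sum_eq_zero fun f _ => ?_
    rw [map_pow, map_sub, AlgHom.commutes]
    simp [eval_eq]
  obtain ⟨p, hp⟩ : ∃ p, k.1 p < ε ^ 2 := by
    by_contra! h
    exact χ.eval_ne_zero (by positivity) h hχk
  refine ⟨p, fun f hf => abs_lt_of_sq_lt_sq ?_ hε.le⟩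
  refine lt_of_le_of_lt ?_ hp
  rw [hk]
  exact Finset.single_le_sum (f := fun f : algebra g => (f.1 p - χ.eval f) ^ 2)
    (fun _ _ => sq_nonneg _) hf

end Character

variable (g)

theorem continuous_pointCharacter : Continuous (pointCharacter g) :=
  Character.continuous_iff.2 fun f => IsRoyden.continuous f.2

theorem denseRange_pointCharacter : DenseRange (pointCharacter g) := by
  intro χ
  rw [mem_closure_iff]
  intro O hO hχ
  obtain ⟨V, hV, rfl⟩ := Character.isInducing_eval.isOpen_iff.1 hO
  obtain ⟨s, u, hu, hsub⟩ := isOpen_pi_iff.1 hV _ hχ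
  have hev : ∀ᶠ ε in nhdsWithin (0 : ℝ) (Set.Ioi 0), ∀ f ∈ s, Metric.ball (χ.eval f) ε ⊆ u f := by
    rw [Filter.eventually_all_finset]
    intro f hf
    obtain ⟨δ, hδ, hball⟩ := Metric.isOpen_iff.1 (hu f hf).1 _ (hu f hf).2
    filter_upwards [Ioo_mem_nhdsGT hδ] with ε hε
    exact (Metric.ball_subset_ball hε.2.le).trans hball
  obtain ⟨ε, hε, hpos⟩ := (hev.and self_mem_nhdsWithin).exists
  obtain ⟨p, hp⟩ := χ.exists_abs_sub_eval_lt s hpos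
  exact ⟨pointCharacter g p, hsub fun f hf => hε f hf (hp f hf), p, rfl⟩

/-- A character that does not vanish on a compactly supported function of the Royden algebra is the
evaluation at a point of its support. -/
theorem mem_image_tsupport_of_eval_ne_zero {χ : Character g} {f : algebra g}
    (hs : HasCompactSupport f.1) (hχ : χ.eval f ≠ 0) : χ ∈ pointCharacter g '' tsupport f.1 := by
  have hclosed : IsClosed (pointCharacter g '' tsupport f.1) :=
    (hs.isCompact.image (continuous_pointCharacter g)).isClosed
  have hopen : IsOpen {ψ : Character g | ψ.eval f ≠ 0} :=
    isOpen_ne_fun (Character.continuous_eval f) continuous_const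
  by_contra hnot
  obtain ⟨_, ⟨h1, h2⟩, p, rfl⟩ := mem_closure_iff.1 (denseRange_pointCharacter g χ) _
    (hopen.inter hclosed.isOpen_compl) ⟨hχ, hnot⟩
  exact h2 ⟨p, subset_tsupport _ h1, rfl⟩

theorem injective_pointCharacter [T2Space R] : Function.Injective (pointCharacter g) := by
  intro p q hpq
  by_contra hne
  obtain ⟨f, hf, -, hsub, hp⟩ := exists_mem_algebra_tsupport_subset g
    (isOpen_compl_singleton.mem_nhds (show p ∈ ({q} : Set R)ᶜ from hne))
  have heq : f p = f q := congrArg (fun χ => χ.eval ⟨f, hf⟩) hpq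
  exact hsub (subset_tsupport f (heq ▸ hp : f q ≠ 0)) rfl

theorem isOpenMap_pointCharacter [T2Space R] : IsOpenMap (pointCharacter g) := by
  refine isOpenMap_iff_nhds_le.2 fun p => Filter.le_map fun U hU => ?_
  obtain ⟨f, hf, hs, hsub, hp⟩ := exists_mem_algebra_tsupport_subset g hU
  have hopen : IsOpen {ψ : Character g | ψ.eval ⟨f, hf⟩ ≠ 0} :=
    isOpen_ne_fun (Character.continuous_eval _) continuous_const
  exact Filter.mem_of_superset (hopen.mem_nhds hp) fun χ hχ =>
    Set.image_mono hsub (mem_image_tsupport_of_eval_ne_zero g (f := ⟨f, hf⟩) hs hχ)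

theorem isCompactification_pointCharacter [T2Space R] :
    IsCompactification g (pointCharacter g) where
  compactSpace := inferInstance
  t2Space := inferInstance
  isOpenEmbedding := .of_continuous_injective_isOpenMap (continuous_pointCharacter g)
    (injective_pointCharacter g) (isOpenMap_pointCharacter g)
  denseRange := denseRange_pointCharacter g
  exists_extension f hf := ⟨fun χ => χ.eval ⟨f, hf⟩, Character.continuous_eval _, fun _ => rfl⟩
  separates χ ψ hne := by
    obtain ⟨f, hf⟩ := not_forall.1 (mt Character.ext hne)
    exact ⟨f.1, f.2, fun χ => χ.eval f, Character.continuous_eval f, fun _ => rfl, hf⟩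

end Characters

/-! ### Identification of a compactification with the space of characters -/

namespace IsCompactification

variable {m : ℕ} {R : Type*} [TopologicalSpace R] [ChartedSpace (EuclideanSpace ℝ (Fin m)) R]
  [IsManifold (𝓡 m) ∞ R] {g : Metric m R} {X : Type*} [TopologicalSpace X] {ι : R → X}

/-- The continuous extension to a Royden compactification of a function in the Royden algebra. -/
def extension (h : IsCompactification g ι) (f : algebra g) : X → ℝ :=
  (h.exists_extension f.1 f.2).choose

theorem continuous_extension (h : IsCompactification g ι) (f : algebra g) :
    Continuous (h.extension f) :=
  (h.exists_extension f.1 f.2).choose_spec.1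

theorem extension_apply (h : IsCompactification g ι) (f : algebra g) (p : R) :
    h.extension f (ι p) = f.1 p :=
  (h.exists_extension f.1 f.2).choose_spec.2 p

theorem eq_extension (h : IsCompactification g ι) {f : algebra g} {F : X → ℝ} (hF : Continuous F)
    (hFf : ∀ p, F (ι p) = f.1 p) : F = h.extension f :=
  h.denseRange.equalizer hF (h.continuous_extension f) <| funext fun p =>
    (hFf p).trans (h.extension_apply f p).symm

/-- The character `f ↦ f̄(x)` of evaluation at a point of a Royden compactification. -/
def toCharacter (h : IsCompactification g ι) (x : X) : Character g :=
  AlgHom.ofLinearMap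
    { toFun := fun f => h.extension f x
      map_add' := fun f k => congrFun (h.eq_extension (f := f + k)
        ((h.continuous_extension f).add (h.continuous_extension k)) fun p => by
          simp [extension_apply]).symm x
      map_smul' := fun r f => congrFun (h.eq_extension (f := r • f)
        ((h.continuous_extension f).const_smul r) fun p => by simp [extension_apply]).symm x }
    (congrFun (h.eq_extension (f := 1) (F := fun _ => 1) continuous_const fun _ => rfl).symm x)
    (fun f k => congrFun (h.eq_extension (f := f * k)
      ((h.continuous_extension f).mul (h.continuous_extension k)) fun p => by
        simp [extension_apply]).symm x)

theorem eval_toCharacter (h : IsCompactification g ι) (x : X) (f : algebra g) :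
    (h.toCharacter x).eval f = h.extension f x := rfl

theorem toCharacter_apply (h : IsCompactification g ι) (p : R) :
    h.toCharacter (ι p) = pointCharacter g p :=
  Character.ext fun f => h.extension_apply f p

theorem continuous_toCharacter (h : IsCompactification g ι) : Continuous h.toCharacter :=
  Character.continuous_iff.2 h.continuous_extension

theorem injective_toCharacter (h : IsCompactification g ι) :
    Function.Injective h.toCharacter := by
  intro x y hxy
  by_contra hne
  obtain ⟨f, hf, F, hF, hFf, hFxy⟩ := h.separates x y hne
  rw [h.eq_extension (f := ⟨f, hf⟩) hF hFf] at hFxy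
  exact hFxy (congrArg (fun χ => χ.eval ⟨f, hf⟩) hxy)

theorem surjective_toCharacter (h : IsCompactification g ι) :
    Function.Surjective h.toCharacter := by
  have := h.compactSpace
  have hdense : DenseRange h.toCharacter := (denseRange_pointCharacter g).mono <| by
    rintro _ ⟨p, rfl⟩
    exact ⟨ι p, h.toCharacter_apply p⟩
  rw [← Set.range_eq_univ, ← hdense.closure_range]
  exact (isCompact_range h.continuous_toCharacter).isClosed.closure_eq.symm

/-- Evaluation of continuous extensions identifies a Royden compactification with the space of
characters. -/
def homeomorph (h : IsCompactification g ι) : X ≃ₜ Character g :=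
  have := h.compactSpace
  Continuous.homeoOfEquivCompactToT2
    (f := Equiv.ofBijective h.toCharacter ⟨h.injective_toCharacter, h.surjective_toCharacter⟩)
    h.continuous_toCharacter

theorem homeomorph_apply (h : IsCompactification g ι) (x : X) :
    h.homeomorph x = h.toCharacter x := rfl

end IsCompactification

end Royden

end

theorem mainTheorem6 {m : ℕ} {R : Type u} [TopologicalSpace R] [T2Space R]
    [SecondCountableTopology R] [ChartedSpace (EuclideanSpace ℝ (Fin m)) R]
    [IsManifold (𝓡 m) ∞ R] (g : Royden.Metric m R) :
    -- existence
    (∃ (X : Type u) (_ : TopologicalSpace X) (ι : R → X), Royden.IsCompactification g ι) ∧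
    -- uniqueness up to a homeomorphism fixing the points of `R`
    (∀ (X : Type v) [TopologicalSpace X] (ι : R → X) (Y : Type w) [TopologicalSpace Y] (κ : R → Y),
      Royden.IsCompactification g ι → Royden.IsCompactification g κ →
        ∃ h : X ≃ₜ Y, ∀ p : R, h (ι p) = κ p) ∧
    -- the character space with the weak-* topology is a Royden compactification
    Royden.IsCompactification g (Royden.pointCharacter g) ∧
    -- every Royden compactification is identified with it by `x ↦ (f ↦ f̄(x))`
    (∀ (X : Type v) [TopologicalSpace X] (ι : R → X), Royden.IsCompactification g ι →
      ∃ σ : X ≃ₜ Royden.Character g, (∀ p : R, σ (ι p) = Royden.pointCharacter g p) ∧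
        ∀ (f : Royden.algebra g) (F : X → ℝ), Continuous F → (∀ p : R, F (ι p) = f.1 p) →
          ∀ x : X, (σ x).eval f = F x) := by
  refine ⟨⟨Royden.Character g, inferInstance, Royden.pointCharacter g,
    Royden.isCompactification_pointCharacter g⟩, ?_,
    Royden.isCompactification_pointCharacter g, ?_⟩
  · intro X _ ι Y _ κ hX hY
    refine ⟨hX.homeomorph.trans hY.homeomorph.symm, fun p => ?_⟩
    rw [Homeomorph.trans_apply, Homeomorph.symm_apply_eq, hX.homeomorph_apply, hY.homeomorph_apply,
      hX.toCharacter_apply, hY.toCharacter_apply]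
  · intro X _ ι hX
    refine ⟨hX.homeomorph, hX.toCharacter_apply, fun f F hF hFf x => ?_⟩
    rw [hX.homeomorph_apply, hX.eval_toCharacter, hX.eq_extension hF hFf]
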